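/- An $\ell$-player game $G$ ($\ell\ge 1$) has finite non-empty query alphabets $\mathcal X_1,\dots,\mathcal X_\ell$ and answer alphabets $\mathcal A_1,\dots,\mathcal A_\ell$, a probability distribution $T$ on $\underline{\mathcal X}=\mathcal X_1\times\dots\times\mathcal X_\ell$ and a predicate $V:\underline{\mathcal A}\times\underline{\mathcal X}\to\{0,1\}$, where $\underline{\mathcal A}=\mathcal A_1\times\dots\times\mathcal A_\ell$. For $I\subset[\ell]=\{1,\dots,\ell\}$ write $\mathcal X_I=\prod_{i\in I}\mathcal X_i$, $\mathcal A_I=\prod_{i\in I}\mathcal A_i$. A family of densities $P(\underline a|\underline x)\ge 0$ is sub-no-signalling if for every $I\subsetneq[\ell]$ there are probability distributions $Q(\cdot|x_I)$ on $\mathcal A_I$ ($x_I\in\mathcal X_I$) such that $\sum_{a_{I^c}}P(a_Ia_{I^c}|\underline x)\le Q(a_I|x_I)$ for all $\underline x\in\underline{\mathcal X}$ and $a_I\in\mathcal A_I$. The sub-no-signalling value $\omega_{\mathrm{SNOS}}(G)$ is the maximum of $\sum_{\underline a,\underline x}T(\underline x)V(\underline a,\underline x)P(\underline a|\underline x)$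 over all sub-no-signalling $P$. For $n\in\mathbb N$, the games $G^n$ and $G^{t/n}$ are the $\ell$-player games with alphabets $\mathcal X_i^n$, $\mathcal A_i^n$ and query distribution $T^{\otimes n}$, won if the answers win all $n$ rounds, respectively at least $t$ of the $n$ rounds, each round being judged by $V$. **Theorem.** Let $C_\ell=2^{\ell+1}-3$ and let $G$ be an $\ell$-player game such that $\omega_{\mathrm{SNOS}}(G)\le 1-\delta$ for some $0<\delta<1$. Then, for every $n\in\mathbb N$, $$\omega_{\mathrm{SNOS}}(G^n)\le\left(1-\frac{\delta^2}{5C_\ell^2}\right)^n,$$ and, for every $n\in\mathbb N$, every $0<\alpha\le\delta$ and every $t\ge(1-\delta+\alpha)n$, $$\omega_{\mathrm{SNOS}}(G^{t/n})\le\exp\left(-n\frac{\alpha^2}{5C_\ell^2}\right).$$ -/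

import Mathlib

/-!
Games with `ℓ` players, indexed by `Fin ℓ`.  Player `i` has a finite query alphabet `X i` and a
finite answer alphabet `A i`; a joint query is `x : ∀ i, X i`, a joint answer is `a : ∀ i, A i`.
For a set `I` of players, `I.restrict x` is the tuple of the queries of the players in `I`.
-/

/-- An `ℓ`-player game: a probability distribution `T` on the joint queries and a binary
predicate `V` on joint answers and joint queries (`true` means that the players win). -/
structure Game {ℓ : ℕ} (X A : Fin ℓ → Type*) [∀ i, Fintype (X i)] where
  /-- The distribution of the queries. -/
  T : (∀ i, X i) → ℝ
  /-- `T` is a probability distribution. -/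
  T_mem : T ∈ stdSimplex ℝ (∀ i, X i)
  /-- The winning predicate. -/
  V : (∀ i, A i) → (∀ i, X i) → Bool

open Classical in
/-- The marginal density `P(a_I | x)`, the sum of `P(a | x)` over all joint answers `a`
that extend the answers `aI` of the players in `I`. -/
noncomputable def marginal {ℓ : ℕ} {X A : Fin ℓ → Type*} [∀ i, Fintype (A i)]
    (P : (∀ i, A i) → (∀ i, X i) → ℝ) (I : Finset (Fin ℓ))
    (aI : ∀ i : I, A i) (x : ∀ i, X i) : ℝ :=
  ∑ a : ∀ i, A i with I.restrict a = aI, P a x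

/-- Sub-no-signalling correlations: nonnegative densities `P(a | x)` such that for every proper
subset `I` of the players there are probability distributions `Q(· | x_I)` on the answers of
the players in `I` with `P(a_I | x) ≤ Q(a_I | x_I)` for all `x` and `a_I`. -/
def IsSNOS {ℓ : ℕ} {X A : Fin ℓ → Type*} [∀ i, Fintype (A i)]
    (P : (∀ i, A i) → (∀ i, X i) → ℝ) : Prop :=
  (∀ a x, 0 ≤ P a x) ∧
    ∀ I : Finset (Fin ℓ), I ⊂ Finset.univ →
      ∃ Q : (∀ i : I, A i) → (∀ i : I, X i) → ℝ,
        (∀ xI, (fun aI => Q aI xI) ∈ stdSimplex ℝ (∀ i : I, A i)) ∧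
          ∀ x aI, marginal P I aI x ≤ Q aI (I.restrict x)

namespace Game

variable {ℓ : ℕ} {X A : Fin ℓ → Type*} [∀ i, Fintype (X i)]

/-- The winning probability of the strategy `P` in the game `G`. -/
def winProb [∀ i, Fintype (A i)] (G : Game X A) (P : (∀ i, A i) → (∀ i, X i) → ℝ) : ℝ :=
  ∑ a : ∀ i, A i, ∑ x : ∀ i, X i, G.T x * (if G.V a x then 1 else 0) * P a x

/-- The sub-no-signalling value of `G`: the maximal winning probability over all
sub-no-signalling correlations. -/
noncomputable def snosValue [∀ i, Fintype (A i)] (G : Game X A) : ℝ :=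
  sSup (G.winProb '' {P | IsSNOS P})

/-- The product distribution on `n`-tuples of joint queries. The query of player `i`
in round `k` is `x i k`. -/
def productT (G : Game X A) (n : ℕ) (x : ∀ i, Fin n → X i) : ℝ :=
  ∏ k : Fin n, G.T (fun i => x i k)

theorem productT_mem (G : Game X A) (n : ℕ) :
    G.productT n ∈ stdSimplex ℝ (∀ i, Fin n → X i) := by
  refine ⟨fun x => Finset.prod_nonneg fun k _ => G.T_mem.1 _, ?_⟩
  have h : ∑ y : Fin n → ∀ i, X i, ∏ k, G.T (y k) = 1 := by
    rw [← Fintype.prod_sum (fun (_ : Fin n) (z : ∀ i, X i) => G.T z)]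
    simp [G.T_mem.2]
  rw [← h]
  exact Fintype.sum_equiv (Equiv.piComm fun (i : Fin ℓ) (_ : Fin n) => X i) _ _ fun x => rfl

/-- The `n`-fold parallel repetition `G^n`: the players win if they win all `n` rounds. -/
def parallelRepetition (G : Game X A) (n : ℕ) :
    Game (fun i => Fin n → X i) (fun i => Fin n → A i) where
  T := G.productT n
  T_mem := G.productT_mem n
  V := fun a x => decide (∀ k : Fin n, G.V (fun i => a i k) (fun i => x i k) = true)

/-- The game `G^{t/n}`: `n` instances of `G` are played in parallel and the players win if
they win at least `t` of them. -/
noncomputable def thresholdRepetition (G : Game X A) (n : ℕ) (t : ℝ) :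
    Game (fun i => Fin n → X i) (fun i => Fin n → A i) where
  T := G.productT n
  T_mem := G.productT_mem n
  V := fun a x =>
    decide (t ≤ ((Finset.univ.filter fun k : Fin n =>
      G.V (fun i => a i k) (fun i => x i k) = true).card : ℝ))

end Game

/-- The constant `C_ℓ = 2^(ℓ+1) - 3`. -/
def playerConst (ℓ : ℕ) : ℝ := 2 ^ (ℓ + 1) - 3

/-! The proof converts a dual certificate for one round into an exponential moment bound for `n`
rounds. Cutting densities down to sub-no-signalling ones (`exists_isSNOS_le`) shows that arbitrary
nonnegative densities beat the value by at most the total positive excess of their marginals over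
given distributions. Separation (`exists_multipliers`) linearises this penalty, and `exists_dual`
extracts weights `z I` in `[0, 1]`, one for each proper subset `I`, that sum to at least 1 on
winning answers to queries of positive probability, while the best expected weights `p I` obtainable
by the groups `I` sum to at most `ω`.

In `n` rounds the number of wins is therefore at most the sum over `I` of the accumulated weights.
The marginal on `I` is dominated by a genuine strategy of the group `I` acting as a single player.
Against a product weight that player does best round by round, so the exponential moment factorises
(`sum_productT_mul_prod_exp_le`). Jensen's inequality over the `2 ^ ℓ - 1` proper subsets combines
these moments (`sum_productT_mul_exp_le`), and Markov's inequality gives the exponent `α ^ 2 / (4 *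
(2 ^ ℓ - 1))`, stronger than required. -/

/-! ### Multipliers from convex separation. -/

/-- Linear programming duality for penalised problems: a convex set of pairs `(w, r)` satisfying
`r ≤ ω + ∑ j, max (w j) 0` satisfies a linear inequality `r ≤ ω + ∑ j, z j * w j` with
multipliers `z j ∈ [0, 1]`. -/
theorem exists_multipliers {ι : Type*} [Fintype ι] {C : Set ((ι → ℝ) × ℝ)} (hC : Convex ℝ C)
    (ω : ℝ) (h : ∀ c ∈ C, c.2 ≤ ω + ∑ j, max (c.1 j) 0) :
    ∃ z : ι → ℝ, (∀ j, 0 ≤ z j ∧ z j ≤ 1) ∧ ∀ c ∈ C, c.2 ≤ ω + ∑ j, z j * c.1 j := by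
  classical
  rcases C.eq_empty_or_nonempty with rfl | ⟨c₀, hc₀⟩
  · exact ⟨0, by simp, by simp⟩
  -- The strict epigraph of the penalty is open, convex and disjoint from `C`.
  set S : Set ((ι → ℝ) × ℝ) := {c | ω + ∑ j, max (c.1 j) 0 < c.2} with hS
  have hSo : IsOpen S := isOpen_lt (by fun_prop) (by fun_prop)
  have hSc : Convex ℝ S := by
    intro c hc d hd a b ha hb hab
    simp only [hS, Set.mem_ofPred_eq, Prod.fst_add, Prod.snd_add, Prod.smul_fst, Prod.smul_snd,
      Pi.add_apply, Pi.smul_apply, smul_eq_mul] at hc hd ⊢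
    have h1 : ∑ j, max (a * c.1 j + b * d.1 j) 0
        ≤ a * ∑ j, max (c.1 j) 0 + b * ∑ j, max (d.1 j) 0 := by
      rw [Finset.mul_sum, Finset.mul_sum, ← Finset.sum_add_distrib]
      refine Finset.sum_le_sum fun j _ => max_le ?_ (by positivity)
      gcongr <;> exact le_max_left _ _
    have h2 : ω = a * ω + b * ω := by rw [← add_mul, hab, one_mul]
    rcases ha.eq_or_lt with rfl | ha'
    · have : b = 1 := by linarith
      subst this
      linarith
    · nlinarith [mul_lt_mul_of_pos_left hc ha', mul_le_mul_of_nonneg_left hd.le hb]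
  have hdis : Disjoint S C :=
    Set.disjoint_left.2 fun c hc hc' => absurd (h c hc') (not_le.2 hc)
  obtain ⟨f, u, hfS, hfC⟩ := geometric_hahn_banach_open hSc hSo hC hdis
  set μ : ℝ := f (0, 1) with hμ
  set l : ι → ℝ := fun j => f (Pi.single j 1, 0) with hl
  have hf : ∀ c : (ι → ℝ) × ℝ, f c = ∑ j, l j * c.1 j + μ * c.2 := by
    rintro ⟨w, r⟩
    have e : ((w, r) : (ι → ℝ) × ℝ) = ∑ j, w j • ((Pi.single j 1, 0) : (ι → ℝ) × ℝ)
        + r • ((0, 1) : (ι → ℝ) × ℝ) := by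
      ext k
      · simp [Prod.fst_sum, Finset.sum_apply, Pi.single_apply]
      · simp [Prod.snd_sum]
    rw [e, map_add, map_sum, map_smul]
    simp only [map_smul, smul_eq_mul, ← e, hl, hμ]
    congr 1
    · exact Finset.sum_congr rfl fun j _ => mul_comm _ _
    · exact mul_comm _ _
  -- A point of `S` lies above `c₀` with the same first component, so the separating hyperplane is
  -- not vertical.
  have hμneg : μ < 0 := by
    have h1 := hfS (c₀.1, ω + ∑ j, max (c₀.1 j) 0 + 1) (by simp [hS])
    have h2 := hfC c₀ hc₀
    have h3 := h c₀ hc₀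
    rw [hf] at h1 h2
    simp only at h1
    by_contra hcon
    nlinarith [mul_nonneg (not_lt.1 hcon) (sub_nonneg.2 h3)]
  have hcl : ∀ w : ι → ℝ, ∑ j, l j * w j + μ * (ω + ∑ j, max (w j) 0) ≤ u := by
    intro w
    refine le_of_forall_pos_lt_add fun ε hε => ?_
    have h1 := hfS (w, ω + ∑ j, max (w j) 0 + ε / (-μ))
      (by simpa [hS] using div_pos hε (neg_pos.2 hμneg))
    rw [hf] at h1
    have h2 : μ * (ε / (-μ)) = -ε := by
      have := hμneg.ne
      rw [div_neg, mul_neg, mul_div_cancel₀ _ this]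
    simp only at h1
    rw [mul_add, h2] at h1
    linarith
  have h0 : μ * ω ≤ u := by simpa using hcl 0
  have hsingle : ∀ (j : ι) (s : ℝ), l j * s + μ * (ω + max s 0) ≤ u := by
    intro j s
    have h1 := hcl (Pi.single j s)
    have h2 : ∑ k, l k * (Pi.single j s : ι → ℝ) k = l j * s := by
      simp [Pi.single_apply]
    have h3 : ∑ k, max ((Pi.single j s : ι → ℝ) k) 0 = max s 0 := by
      rw [Finset.sum_eq_single j (fun k _ hk => by simp [hk]) (by simp)]
      simp
    rwa [h2, h3] at h1
  -- A linear function bounded above on a ray has nonpositive slope. The rays `s → ∞` and `s → -∞`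
  -- in `hsingle` give `l j ≤ -μ` and `0 ≤ l j`.
  have key : ∀ d : ℝ, (∀ s : ℝ, 0 ≤ s → d * s ≤ u - μ * ω) → d ≤ 0 := by
    intro d hd
    by_contra! hcon
    have h1 := hd ((u - μ * ω + 1) / d) (div_nonneg (by linarith) hcon.le)
    rw [mul_div_cancel₀ _ hcon.ne'] at h1
    linarith
  have hl1 : ∀ j, l j + μ ≤ 0 := fun j => key _ fun s hs => by
    have := hsingle j s
    rw [max_eq_left hs] at this
    linarith
  have hl0 : ∀ j, 0 ≤ l j := fun j => by
    have : -l j ≤ 0 := key _ fun s hs => by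
      have := hsingle j (-s)
      rw [max_eq_right (by linarith)] at this
      linarith
    linarith
  refine ⟨fun j => l j / (-μ), fun j => ⟨div_nonneg (hl0 j) (by linarith),
    (div_le_one (by linarith)).2 (by linarith [hl1 j])⟩, fun c hc => ?_⟩
  have h1 := hfC c hc
  rw [hf] at h1
  have h2 : ∑ j, l j / (-μ) * c.1 j = (∑ j, l j * c.1 j) / (-μ) := by
    rw [Finset.sum_div]
    exact Finset.sum_congr rfl fun j _ => by ring
  rw [h2, ← sub_le_iff_le_add', le_div_iff₀ (by linarith)]
  linarith

/-! ### Marginals and truncation to sub-no-signalling densities. -/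

/-- The proper subsets of the set of players. -/
abbrev ProperSubset (ℓ : ℕ) : Type := {I : Finset (Fin ℓ) // I ⊂ Finset.univ}

theorem card_properSubset (ℓ : ℕ) : (Fintype.card (ProperSubset ℓ) : ℝ) = 2 ^ ℓ - 1 := by
  have h : Fintype.card (ProperSubset ℓ) = 2 ^ ℓ - 1 := by
    rw [Fintype.card_of_subtype (Finset.univ : Finset (Fin ℓ)).ssubsets (by simp),
      Finset.ssubsets, Finset.card_erase_of_mem (Finset.mem_powerset_self _),
      Finset.card_powerset, Finset.card_univ, Fintype.card_fin]
  rw [h, Nat.cast_sub Nat.one_le_two_pow]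
  simp

theorem one_sub_prod_le_sum_one_sub {ι : Type*} (s : Finset ι) (r : ι → ℝ)
    (h0 : ∀ i, 0 ≤ r i) (h1 : ∀ i, r i ≤ 1) : 1 - ∏ i ∈ s, r i ≤ ∑ i ∈ s, (1 - r i) := by
  classical
  induction s using Finset.induction_on with
  | empty => simp
  | insert i s hi ih =>
    rw [Finset.prod_insert hi, Finset.sum_insert hi]
    have h2 : ∏ i ∈ s, r i ≤ 1 := Finset.prod_le_one (fun i _ => h0 i) fun i _ => h1 i
    nlinarith [mul_nonneg (sub_nonneg.2 (h1 i)) (sub_nonneg.2 h2)]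

section Marginal

variable {ℓ : ℕ} {X A : Fin ℓ → Type*} [∀ i, Fintype (A i)]

theorem sum_marginal_mul (P : (∀ i, A i) → (∀ i, X i) → ℝ) (I : Finset (Fin ℓ))
    (φ : (∀ i : I, A i) → ℝ) (x : ∀ i, X i) :
    ∑ aI, marginal P I aI x * φ aI = ∑ a, P a x * φ (I.restrict a) := by
  simp only [marginal, Finset.sum_filter, Finset.sum_mul]
  rw [Finset.sum_comm]
  refine Finset.sum_congr rfl fun a _ => ?_
  rw [Finset.sum_eq_single (I.restrict a) (fun b _ hb => by simp [hb.symm]) (by simp)]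
  simp

theorem marginal_nonneg {P : (∀ i, A i) → (∀ i, X i) → ℝ} (hP : ∀ a x, 0 ≤ P a x)
    (I : Finset (Fin ℓ)) (aI : ∀ i : I, A i) (x : ∀ i, X i) : 0 ≤ marginal P I aI x :=
  Finset.sum_nonneg fun _ _ => hP _ _

theorem marginal_add_smul (P P' : (∀ i, A i) → (∀ i, X i) → ℝ) (s t : ℝ)
    (I : Finset (Fin ℓ)) (aI : ∀ i : I, A i) (x : ∀ i, X i) :
    marginal (s • P + t • P') I aI x = s * marginal P I aI x + t * marginal P' I aI x := by
  simp [marginal, Finset.sum_add_distrib, Finset.mul_sum]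

theorem IsSNOS.sum_le_one (hℓ : 1 ≤ ℓ) {P : (∀ i, A i) → (∀ i, X i) → ℝ} (hP : IsSNOS P)
    (x : ∀ i, X i) : ∑ a, P a x ≤ 1 := by
  have : NeZero ℓ := ⟨by omega⟩
  obtain ⟨Q, hQ, hPQ⟩ := hP.2 ∅ (Finset.empty_ssubset.2 Finset.univ_nonempty)
  have h1 := sum_marginal_mul P ∅ (fun _ => 1) x
  simp only [mul_one] at h1
  rw [← h1, ← (hQ (Finset.restrict ∅ x)).2]
  exact Finset.sum_le_sum fun aI _ => hPQ x aI

/-- Cutting a family of densities down to a sub-no-signalling one, at the cost of the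
excess of its marginals over given distributions. -/
theorem exists_isSNOS_le {P : (∀ i, A i) → (∀ i, X i) → ℝ} (hP : ∀ a x, 0 ≤ P a x)
    (Q : ∀ I : ProperSubset ℓ, (∀ i : I.1, A i) → (∀ i : I.1, X i) → ℝ)
    (hQ : ∀ (I : ProperSubset ℓ) xI, (fun aI => Q I aI xI) ∈ stdSimplex ℝ (∀ i : I.1, A i)) :
    ∃ P' : (∀ i, A i) → (∀ i, X i) → ℝ, IsSNOS P' ∧ (∀ a x, P' a x ≤ P a x) ∧
      ∀ x, ∑ a, (P a x - P' a x) ≤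
        ∑ I : ProperSubset ℓ, ∑ aI, max (marginal P I.1 aI x - Q I aI (I.1.restrict x)) 0 := by
  classical
  -- This is `min 1 (Q / marginal)`; a zero marginal falls under the first case.
  set r : ∀ I : ProperSubset ℓ, (∀ i : I.1, A i) → (∀ i, X i) → ℝ := fun I aI x =>
    if marginal P I.1 aI x ≤ Q I aI (I.1.restrict x) then 1
    else Q I aI (I.1.restrict x) / marginal P I.1 aI x with hr
  have hQ0 : ∀ I aI xI, 0 ≤ Q I aI xI := fun I aI xI => (hQ I xI).1 aI
  have hr0 : ∀ I aI x, 0 ≤ r I aI x := by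
    intro I aI x
    simp only [hr]
    split_ifs
    · exact zero_le_one
    · exact div_nonneg (hQ0 _ _ _) (marginal_nonneg hP _ _ _)
  have hr1 : ∀ I aI x, r I aI x ≤ 1 := by
    intro I aI x
    simp only [hr]
    split_ifs with h
    · exact le_rfl
    · exact div_le_one_of_le₀ (not_le.1 h).le (marginal_nonneg hP _ _ _)
  have hrm : ∀ I aI x, marginal P I.1 aI x * (1 - r I aI x)
      = max (marginal P I.1 aI x - Q I aI (I.1.restrict x)) 0 := by
    intro I aI x
    simp only [hr]
    split_ifs with h
    · rw [max_eq_right (by linarith)]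
      ring
    · have h1 := not_le.1 h
      have h2 := ((hQ0 _ _ _).trans_lt h1).ne'
      rw [max_eq_left (by linarith), mul_sub, mul_div_cancel₀ _ h2, mul_one]
  have hprod0 : ∀ a x, 0 ≤ ∏ I : ProperSubset ℓ, r I (I.1.restrict a) x := fun a x =>
    Finset.prod_nonneg fun I _ => hr0 _ _ _
  refine ⟨fun a x => P a x * ∏ I : ProperSubset ℓ, r I (I.1.restrict a) x,
    ⟨fun a x => mul_nonneg (hP a x) (hprod0 a x), fun I hI => ⟨Q ⟨I, hI⟩, hQ ⟨I, hI⟩, ?_⟩⟩,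
    fun a x => mul_le_of_le_one_right (hP a x)
      (Finset.prod_le_one (fun I _ => hr0 _ _ _) fun I _ => hr1 _ _ _), fun x => ?_⟩
  · intro x aI
    -- For the constraint at `I`, every factor other than `r I` is bounded by 1.
    have h1 : marginal (fun a x => P a x * ∏ I : ProperSubset ℓ, r I (I.1.restrict a) x) I aI x
        ≤ marginal P I aI x * r ⟨I, hI⟩ aI x := by
      rw [marginal, marginal, Finset.sum_mul]
      refine Finset.sum_le_sum fun a ha => mul_le_mul_of_nonneg_left ?_ (hP a x)
      rw [← (Finset.mem_filter.1 ha).2, ← Finset.mul_prod_erase _ _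
        (Finset.mem_univ (⟨I, hI⟩ : ProperSubset ℓ))]
      exact mul_le_of_le_one_right (hr0 _ _ _)
        (Finset.prod_le_one (fun I _ => hr0 _ _ _) fun I _ => hr1 _ _ _)
    have h2 := hrm ⟨I, hI⟩ aI x
    have h3 := le_max_left (marginal P I aI x - Q ⟨I, hI⟩ aI (I.restrict x)) 0
    simp only at h2
    linarith
  · calc ∑ a, (P a x - P a x * ∏ I : ProperSubset ℓ, r I (I.1.restrict a) x)
        ≤ ∑ a, ∑ I : ProperSubset ℓ, P a x * (1 - r I (I.1.restrict a) x) := by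
          refine Finset.sum_le_sum fun a _ => ?_
          rw [← Finset.mul_sum, ← mul_one_sub]
          exact mul_le_mul_of_nonneg_left (one_sub_prod_le_sum_one_sub _ _
            (fun _ => hr0 _ _ _) fun _ => hr1 _ _ _) (hP a x)
      _ = ∑ I : ProperSubset ℓ, ∑ aI,
            max (marginal P I.1 aI x - Q I aI (I.1.restrict x)) 0 := by
          rw [Finset.sum_comm]
          refine Finset.sum_congr rfl fun I _ => ?_
          simp only [← hrm]
          exact (sum_marginal_mul P I.1 (fun aI => 1 - r I aI x) x).symm

end Marginal

/-! ### Winning probability and the penalty bound. -/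

namespace Game

variable {ℓ : ℕ} {X A : Fin ℓ → Type*} [∀ i, Fintype (X i)] [∀ i, Fintype (A i)]

theorem winProb_eq (G : Game X A) (P : (∀ i, A i) → (∀ i, X i) → ℝ) :
    G.winProb P = ∑ x, G.T x * ∑ a, (if G.V a x then 1 else 0) * P a x := by
  rw [winProb, Finset.sum_comm]
  simp only [Finset.mul_sum, mul_assoc]

theorem winProb_add_smul (G : Game X A) (P P' : (∀ i, A i) → (∀ i, X i) → ℝ) (s t : ℝ) :
    G.winProb (s • P + t • P') = s * G.winProb P + t * G.winProb P' := by
  simp only [winProb, Finset.mul_sum, ← Finset.sum_add_distrib]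
  refine Finset.sum_congr rfl fun a _ => Finset.sum_congr rfl fun x _ => ?_
  simp only [Pi.add_apply, Pi.smul_apply, smul_eq_mul]
  ring

theorem winProb_le_one (hℓ : 1 ≤ ℓ) (G : Game X A) {P : (∀ i, A i) → (∀ i, X i) → ℝ}
    (hP : IsSNOS P) : G.winProb P ≤ 1 := by
  refine le_trans ?_ G.T_mem.2.le
  rw [winProb_eq]
  refine Finset.sum_le_sum fun x _ => mul_le_of_le_one_right (G.T_mem.1 x) ?_
  refine le_trans (Finset.sum_le_sum fun a _ => ?_) (hP.sum_le_one hℓ x)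
  split_ifs
  · rw [one_mul]
  · rw [zero_mul]
    exact hP.1 a x

theorem winProb_le_snosValue (hℓ : 1 ≤ ℓ) (G : Game X A) {P : (∀ i, A i) → (∀ i, X i) → ℝ}
    (hP : IsSNOS P) : G.winProb P ≤ G.snosValue :=
  le_csSup ⟨1, by rintro _ ⟨P, hP, rfl⟩; exact G.winProb_le_one hℓ hP⟩ ⟨P, hP, rfl⟩

/-- The winning probability of arbitrary densities exceeds the value by at most the excess of
their marginals over given distributions. -/
theorem winProb_le_add_sum_max (G : Game X A) {ω : ℝ} (hG : ∀ P, IsSNOS P → G.winProb P ≤ ω)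
    {P : (∀ i, A i) → (∀ i, X i) → ℝ} (hP : ∀ a x, 0 ≤ P a x)
    (Q : ∀ I : ProperSubset ℓ, (∀ i : I.1, A i) → (∀ i : I.1, X i) → ℝ)
    (hQ : ∀ (I : ProperSubset ℓ) xI, (fun aI => Q I aI xI) ∈ stdSimplex ℝ (∀ i : I.1, A i)) :
    G.winProb P ≤ ω + ∑ I : ProperSubset ℓ, ∑ aI, ∑ x,
      max (G.T x * (marginal P I.1 aI x - Q I aI (I.1.restrict x))) 0 := by
  obtain ⟨P', hP', hle, hloss⟩ := exists_isSNOS_le hP Q hQ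
  have h1 : ∑ I : ProperSubset ℓ, ∑ aI, ∑ x,
      max (G.T x * (marginal P I.1 aI x - Q I aI (I.1.restrict x))) 0
      = ∑ x, G.T x * ∑ I : ProperSubset ℓ, ∑ aI,
        max (marginal P I.1 aI x - Q I aI (I.1.restrict x)) 0 := by
    simp only [Finset.mul_sum]
    rw [Finset.sum_comm]
    refine Finset.sum_congr rfl fun I _ => ?_
    rw [Finset.sum_comm]
    refine Finset.sum_congr rfl fun x _ => Finset.sum_congr rfl fun aI _ => ?_
    rw [mul_max_of_nonneg _ _ (G.T_mem.1 x), mul_zero]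
  refine le_trans ?_ (add_le_add_left (hG P' hP') _)
  rw [h1, winProb_eq, winProb_eq, ← Finset.sum_add_distrib]
  refine Finset.sum_le_sum fun x _ => ?_
  rw [← mul_add]
  refine mul_le_mul_of_nonneg_left (le_trans ?_ (add_le_add_right (hloss x) _)) (G.T_mem.1 x)
  rw [← Finset.sum_add_distrib]
  refine Finset.sum_le_sum fun a _ => ?_
  have := hle a x
  split_ifs <;> linarith

end Game

/-! ### The dual certificate. -/

namespace Game

variable {ℓ : ℕ} {X A : Fin ℓ → Type*} [∀ i, Fintype (X i)] [∀ i, Fintype (A i)]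

/-- The excesses and the winning probability depend affinely on `(P, Q)`, so `exists_multipliers`
turns the penalty into a linear bound. The penalty has coefficient 1, whence `z ≤ 1`, which
`exp_mul_le` needs later. -/
theorem exists_winProb_le_linear (G : Game X A) {ω : ℝ}
    (hG : ∀ P, IsSNOS P → G.winProb P ≤ ω) :
    ∃ z : ∀ I : ProperSubset ℓ, (∀ i : I.1, A i) → (∀ i, X i) → ℝ,
      (∀ I aI x, 0 ≤ z I aI x ∧ z I aI x ≤ 1) ∧
      ∀ (P : (∀ i, A i) → (∀ i, X i) → ℝ)
        (b : ∀ I : ProperSubset ℓ, (∀ i : I.1, X i) → ∀ i : I.1, A i), (∀ a x, 0 ≤ P a x) →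
        G.winProb P ≤ ω + ∑ I : ProperSubset ℓ, ∑ x, G.T x *
          (∑ a, P a x * z I (I.1.restrict a) x
            - z I (b I (I.1.restrict x)) x) := by
  classical
  set C : Set (((Σ I : ProperSubset ℓ, (∀ i : I.1, A i) × (∀ i, X i)) → ℝ) × ℝ) :=
    {c | ∃ (P : (∀ i, A i) → (∀ i, X i) → ℝ)
      (Q : ∀ I : ProperSubset ℓ, (∀ i : I.1, A i) → (∀ i : I.1, X i) → ℝ),
      (∀ a x, 0 ≤ P a x) ∧
      (∀ (I : ProperSubset ℓ) xI, (fun aI => Q I aI xI) ∈ stdSimplex ℝ (∀ i : I.1, A i)) ∧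
      c = (fun j => G.T j.2.2 *
        (marginal P j.1.1 j.2.1 j.2.2 - Q j.1 j.2.1 (j.1.1.restrict j.2.2)), G.winProb P)}
    with hCdef
  have hC : Convex ℝ C := by
    rintro _ ⟨P, Q, hP, hQ, rfl⟩ _ ⟨P', Q', hP', hQ', rfl⟩ s t hs ht hst
    refine ⟨s • P + t • P', fun I aI xI => s * Q I aI xI + t * Q' I aI xI, fun a x => ?_,
      fun I xI => convex_stdSimplex ℝ _ (hQ I xI) (hQ' I xI) hs ht hst, ?_⟩
    · exact add_nonneg (mul_nonneg hs (hP a x)) (mul_nonneg ht (hP' a x))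
    · rw [winProb_add_smul]
      simp only [marginal_add_smul]
      refine Prod.ext ?_ rfl
      funext j
      simp only [Prod.fst_add, Prod.smul_fst, Pi.add_apply, Pi.smul_apply, smul_eq_mul]
      ring
  obtain ⟨z, hz, hzC⟩ := exists_multipliers hC ω (by
    rintro _ ⟨P, Q, hP, hQ, rfl⟩
    simp only [Fintype.sum_sigma, Fintype.sum_prod_type]
    exact G.winProb_le_add_sum_max hG hP Q hQ)
  refine ⟨fun I aI x => z ⟨I, aI, x⟩, fun I aI x => hz _, fun P b hP => ?_⟩
  -- Only point masses `Q` are needed, because the bound is used against deterministic responses.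
  have h := hzC _ ⟨P, fun I aI xI => (Pi.single (b I xI) 1 : (∀ i : I.1, A i) → ℝ) aI, hP,
    fun I xI => single_mem_stdSimplex ℝ (b I xI), rfl⟩
  simp only [Fintype.sum_sigma, Fintype.sum_prod_type] at h
  refine h.trans_eq ?_
  congr 1
  refine Finset.sum_congr rfl fun I _ => ?_
  rw [Finset.sum_comm]
  refine Finset.sum_congr rfl fun x _ => ?_
  rw [← sum_marginal_mul P I.1 (fun aI => z ⟨I, aI, x⟩) x]
  have h1 : z ⟨I, b I (I.1.restrict x), x⟩
      = ∑ aI, (Pi.single (b I (I.1.restrict x)) 1 : _ → ℝ) aI * z ⟨I, aI, x⟩ := by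
    simp [Pi.single_apply]
  simp only [h1]
  rw [← Finset.sum_sub_distrib, Finset.mul_sum]
  exact Finset.sum_congr rfl fun aI _ => by ring

/-- The dual of the linear program defining the sub-no-signalling value. -/
theorem exists_dual [∀ i, Nonempty (A i)] (G : Game X A) {ω : ℝ}
    (hG : ∀ P, IsSNOS P → G.winProb P ≤ ω) :
    ∃ z : ∀ I : ProperSubset ℓ, (∀ i : I.1, A i) → (∀ i, X i) → ℝ,
      (∀ I aI x, 0 ≤ z I aI x ∧ z I aI x ≤ 1) ∧
      (∀ a x, G.V a x = true → 0 < G.T x → 1 ≤ ∑ I, z I (I.1.restrict a) x) ∧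
      ∀ b : ∀ I : ProperSubset ℓ, (∀ i : I.1, X i) → ∀ i : I.1, A i,
        ∑ I : ProperSubset ℓ, ∑ x, G.T x * z I (b I (I.1.restrict x)) x ≤ ω := by
  classical
  obtain ⟨z, hz, h⟩ := G.exists_winProb_le_linear hG
  have hω : ∀ b : ∀ I : ProperSubset ℓ, (∀ i : I.1, X i) → ∀ i : I.1, A i,
        ∑ I : ProperSubset ℓ, ∑ x, G.T x * z I (b I (I.1.restrict x)) x ≤ ω := by
    intro b
    have h1 := h 0 b (fun _ _ => le_rfl)
    simp only [winProb, Pi.zero_apply, mul_zero, zero_mul, Finset.sum_const_zero, zero_sub,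
      mul_neg, Finset.sum_neg_distrib] at h1
    linarith
  refine ⟨z, hz, fun a x hV hT => ?_, hω⟩
  set b : ∀ I : ProperSubset ℓ, (∀ i : I.1, X i) → ∀ i : I.1, A i :=
    fun I _ i => Classical.arbitrary (A i)
  have hb0 : 0 ≤ ∑ I : ProperSubset ℓ, ∑ x, G.T x * z I (b I (I.1.restrict x)) x :=
    Finset.sum_nonneg fun I _ => Finset.sum_nonneg fun x _ =>
      mul_nonneg (G.T_mem.1 x) (hz _ _ _).1
  have key : ∀ s : ℝ, 0 ≤ s →
      s * G.T x ≤ ω + s * (G.T x * ∑ I, z I (I.1.restrict a) x) := by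
    intro s hs
    -- Mass `s` at the single point `(a, x)`: since `s` is unbounded, the dual constraint there
    -- cannot fail.
    have h1 := h (fun a' x' => if a' = a then (if x' = x then s else 0) else 0) b
      (fun a' x' => by split_ifs <;> simp [hs])
    simp only [winProb, mul_ite, mul_zero, Finset.sum_ite_irrel, Finset.sum_const_zero,
      Finset.sum_ite_eq', Finset.mem_univ, if_true, hV, mul_one, ite_mul, zero_mul, mul_sub,
      Finset.sum_sub_distrib] at h1
    have h2 : ∑ I : ProperSubset ℓ, G.T x * (s * z I (I.1.restrict a) x)
        = s * (G.T x * ∑ I, z I (I.1.restrict a) x) := by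
      rw [Finset.mul_sum, Finset.mul_sum]
      exact Finset.sum_congr rfl fun I _ => by ring
    rw [h2] at h1
    linarith
  by_contra! hcon
  have hd : 0 < G.T x * (1 - ∑ I, z I (I.1.restrict a) x) := mul_pos hT (by linarith)
  have hω0 : 0 ≤ ω := hb0.trans (hω b)
  have h1 := key ((ω + 1) / (G.T x * (1 - ∑ I, z I (I.1.restrict a) x)))
    (div_nonneg (by linarith) hd.le)
  have h2 := div_mul_cancel₀ (ω + 1) hd.ne'
  nlinarith

end Game

/-! ### Exponential moments over `n` rounds. -/

/-- For a product weight, the best joint answer of a group of players in `n` rounds is obtained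
by answering each round optimally. -/
theorem sum_prod_le_pow {X Y A : Type*} [Fintype X] [Fintype Y] [Fintype A] [DecidableEq Y]
    (r : X → Y)
    (w : A → X → ℝ) (hw : ∀ a x, 0 ≤ w a x) (b : Y → A)
    (hb : ∀ a y, ∑ x with r x = y, w a x ≤ ∑ x with r x = y, w (b y) x) {n : ℕ}
    (Q : (Fin n → A) → (Fin n → Y) → ℝ) (hQ : ∀ y, (fun a => Q a y) ∈ stdSimplex ℝ (Fin n → A)) :
    ∑ x : Fin n → X, ∑ a, Q a (fun k => r (x k)) * ∏ k, w (a k) (x k)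
      ≤ (∑ x, w (b (r x)) x) ^ n := by
  classical
  have h1 : ∀ (y : Fin n → Y) (a : Fin n → A),
      ∑ x : Fin n → X with (fun k => r (x k)) = y, ∏ k, w (a k) (x k)
        = ∏ k, ∑ x with r x = y k, w (a k) x := by
    intro y a
    rw [Finset.prod_univ_sum]
    refine Finset.sum_congr ?_ fun _ _ => rfl
    ext x
    simp [Fintype.mem_piFinset, funext_iff]
  have h2 : ∑ x, w (b (r x)) x = ∑ y, ∑ x with r x = y, w (b y) x := by
    rw [← Finset.sum_fiberwise Finset.univ r]
    refine Finset.sum_congr rfl fun y _ => Finset.sum_congr rfl fun x hx => ?_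
    rw [(Finset.mem_filter.1 hx).2]
  rw [h2, ← Fin.prod_const, Finset.prod_univ_sum, Fintype.piFinset_univ,
    ← Finset.sum_fiberwise Finset.univ (fun (x : Fin n → X) k => r (x k))]
  refine Finset.sum_le_sum fun y _ => ?_
  calc ∑ x : Fin n → X with (fun k => r (x k)) = y, ∑ a, Q a (fun k => r (x k)) * ∏ k, w (a k) (x k)
      = ∑ x : Fin n → X with (fun k => r (x k)) = y, ∑ a, Q a y * ∏ k, w (a k) (x k) := by
        refine Finset.sum_congr rfl fun x hx => ?_
        rw [(Finset.mem_filter.1 hx).2]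
    _ = ∑ a, Q a y * ∏ k, ∑ x with r x = y k, w (a k) x := by
        rw [Finset.sum_comm]
        simp only [← Finset.mul_sum, h1]
    _ ≤ ∑ a, Q a y * ∏ k, ∑ x with r x = y k, w (b (y k)) x := by
        refine Finset.sum_le_sum fun a _ => mul_le_mul_of_nonneg_left ?_ ((hQ y).1 a)
        exact Finset.prod_le_prod (fun k _ => Finset.sum_nonneg fun x _ => hw _ _)
          fun k _ => hb _ _
    _ = ∏ k, ∑ x with r x = y k, w (b (y k)) x := by
        rw [← Finset.sum_mul, (hQ y).2, one_mul]

theorem exp_mul_le {u z : ℝ} (h0 : 0 ≤ z) (h1 : z ≤ 1) :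
    Real.exp (u * z) ≤ 1 + (Real.exp u - 1) * z := by
  have h := convexOn_exp.2 (Set.mem_univ 0) (Set.mem_univ u) (sub_nonneg.2 h1) h0 (by ring)
  simp only [smul_eq_mul, mul_zero, zero_add, Real.exp_zero, mul_one] at h
  rw [mul_comm u]
  linarith

theorem sum_pi_swap {ι κ : Type*} [Fintype ι] [Fintype κ] [DecidableEq ι] [DecidableEq κ]
    {X : ι → Type*} [∀ i, Fintype (X i)] (φ : (κ → ∀ i, X i) → ℝ) :
    ∑ x : ∀ i, κ → X i, φ (fun k i => x i k) = ∑ x : κ → ∀ i, X i, φ x :=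
  Fintype.sum_equiv (Equiv.piComm fun (i : ι) (_ : κ) => X i) _ _ fun _ => rfl

namespace Game

variable {ℓ : ℕ} {X A : Fin ℓ → Type*} [∀ i, Fintype (X i)] [∀ i, Fintype (A i)]

/-- The constraint at `I` replaces the marginal of `P` by `Q`, whose best response factorises over
rounds. In each round the chord bound on `exp` makes the moment affine in the expected weight, which
is at most `p`. -/
theorem sum_productT_mul_prod_exp_le [∀ i, Nonempty (A i)] (G : Game X A) (I : ProperSubset ℓ)
    (z : (∀ i : I.1, A i) → (∀ i, X i) → ℝ) (hz : ∀ aI x, 0 ≤ z aI x ∧ z aI x ≤ 1)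
    {p u : ℝ} (hu : 0 ≤ u)
    (hp : ∀ b : (∀ i : I.1, X i) → ∀ i : I.1, A i,
      ∑ x, G.T x * z (b (I.1.restrict x)) x ≤ p) {n : ℕ}
    {P : (∀ i, Fin n → A i) → (∀ i, Fin n → X i) → ℝ} (hP : IsSNOS P) :
    ∑ x, G.productT n x * ∑ a, P a x *
      ∏ k, Real.exp (u * z (I.1.restrict fun i => a i k) (fun i => x i k))
      ≤ Real.exp (n * ((Real.exp u - 1) * p)) := by
  classical
  obtain ⟨Q, hQ, hPQ⟩ := hP.2 I.1 I.2
  have hw0 : ∀ aI x, 0 ≤ G.T x * Real.exp (u * z aI x) := fun aI x =>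
    mul_nonneg (G.T_mem.1 x) (Real.exp_pos _).le
  have hmax : ∀ y : ∀ i : I.1, X i, ∃ b : ∀ i : I.1, A i, ∀ aI,
      ∑ x with I.1.restrict x = y, G.T x * Real.exp (u * z aI x)
        ≤ ∑ x with I.1.restrict x = y, G.T x * Real.exp (u * z b x) :=
    fun y => Finite.exists_max _
  choose b hb using hmax
  calc ∑ x, G.productT n x * ∑ a, P a x *
          ∏ k, Real.exp (u * z (I.1.restrict fun i => a i k) (fun i => x i k))
      ≤ ∑ x, G.productT n x * ∑ aI : ∀ i : I.1, Fin n → A i, Q aI (I.1.restrict x) *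
          ∏ k, Real.exp (u * z (fun i => aI i k) (fun i => x i k)) := by
        refine Finset.sum_le_sum fun x _ =>
          mul_le_mul_of_nonneg_left ?_ ((G.productT_mem n).1 x)
        refine (sum_marginal_mul P I.1 (fun aI => ∏ k, Real.exp
          (u * z (fun i => aI i k) (fun i => x i k))) x).symm.trans_le ?_
        exact Finset.sum_le_sum fun aI _ => mul_le_mul_of_nonneg_right (hPQ x aI)
          (Finset.prod_nonneg fun k _ => (Real.exp_pos _).le)
    _ = ∑ x : ∀ i, Fin n → X i, ∑ aI : ∀ i : I.1, Fin n → A i, Q aI (I.1.restrict x) *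
          ∏ k, (G.T (fun i => x i k) *
            Real.exp (u * z (fun i => aI i k) (fun i => x i k))) := by
        simp only [Finset.mul_sum, productT, Finset.prod_mul_distrib]
        exact Finset.sum_congr rfl fun x _ => Finset.sum_congr rfl fun aI _ => by ring
    _ = ∑ x : Fin n → ∀ i, X i, ∑ aI : Fin n → ∀ i : I.1, A i,
          Q (fun i k => aI k i) (fun i k => I.1.restrict (x k) i) *
          ∏ k, (G.T (x k) * Real.exp (u * z (aI k) (x k))) := by
        rw [← sum_pi_swap]
        refine Finset.sum_congr rfl fun x _ => ?_
        rw [← sum_pi_swap]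
        rfl
    _ ≤ (∑ x, G.T x * Real.exp (u * z (b (I.1.restrict x)) x)) ^ n := by
        refine sum_prod_le_pow I.1.restrict (fun aI x => G.T x * Real.exp (u * z aI x)) hw0 b
          (fun aI y => hb y aI) (fun aI y => Q (fun i k => aI k i) (fun i k => y k i))
          fun y => ⟨fun aI => (hQ _).1 _, ?_⟩
        rw [← sum_pi_swap]
        exact (hQ _).2
    _ ≤ Real.exp ((Real.exp u - 1) * p) ^ n := by
        refine pow_le_pow_left₀ (Finset.sum_nonneg fun x _ => hw0 _ _) ?_ n
        have hu1 : 0 ≤ Real.exp u - 1 := sub_nonneg.2 (Real.one_le_exp hu)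
        calc ∑ x, G.T x * Real.exp (u * z (b (I.1.restrict x)) x)
            ≤ ∑ x, G.T x * (1 + (Real.exp u - 1) * z (b (I.1.restrict x)) x) :=
              Finset.sum_le_sum fun x _ => mul_le_mul_of_nonneg_left
                (exp_mul_le (hz _ _).1 (hz _ _).2) (G.T_mem.1 x)
          _ = 1 + (Real.exp u - 1) * ∑ x, G.T x * z (b (I.1.restrict x)) x := by
              simp only [mul_add, mul_one, Finset.sum_add_distrib, G.T_mem.2, Finset.mul_sum]
              congr 1
              exact Finset.sum_congr rfl fun x _ => by ring
          _ ≤ (Real.exp u - 1) * p + 1 := by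
              rw [add_comm]
              gcongr
              exact hp b
          _ ≤ Real.exp ((Real.exp u - 1) * p) := Real.add_one_le_exp _
    _ = Real.exp (n * ((Real.exp u - 1) * p)) := (Real.exp_nat_mul _ _).symm

/-- Exponential moment bound for the number of rounds that are won. -/
theorem sum_productT_mul_exp_le [∀ i, Nonempty (A i)] (hℓ : 1 ≤ ℓ) (G : Game X A) {ω : ℝ}
    (hG : ∀ P, IsSNOS P → G.winProb P ≤ ω) {s : ℝ} (hs : 0 ≤ s) {n : ℕ}
    {P : (∀ i, Fin n → A i) → (∀ i, Fin n → X i) → ℝ} (hP : IsSNOS P) :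
    ∑ x, G.productT n x * ∑ a, P a x * Real.exp (s * ((Finset.univ.filter fun k : Fin n =>
      G.V (fun i => a i k) (fun i => x i k) = true).card : ℝ))
      ≤ Real.exp (n * ((Real.exp (s * (2 ^ ℓ - 1)) - 1) * ω / (2 ^ ℓ - 1))) := by
  classical
  obtain ⟨z, hz, hV, hω⟩ := G.exists_dual hG
  set m : ℝ := 2 ^ ℓ - 1 with hm
  have hcard : (Fintype.card (ProperSubset ℓ) : ℝ) = m := card_properSubset ℓ
  have hm1 : 1 ≤ m := by
    have : (2 : ℝ) ^ 1 ≤ 2 ^ ℓ := pow_le_pow_right₀ (by norm_num) hℓ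
    rw [hm]; linarith
  have hm0 : 0 < m := by linarith
  set e : ℝ := Real.exp (s * m) - 1 with he
  have hmax : ∀ I : ProperSubset ℓ, ∃ b : (∀ i : I.1, X i) → ∀ i : I.1, A i,
      ∀ b' : (∀ i : I.1, X i) → ∀ i : I.1, A i,
      ∑ x, G.T x * z I (b' (I.1.restrict x)) x ≤ ∑ x, G.T x * z I (b (I.1.restrict x)) x :=
    fun I => Finite.exists_max _
  choose b hb using hmax
  set p : ProperSubset ℓ → ℝ := fun I => ∑ x, G.T x * z I (b I (I.1.restrict x)) x with hp
  have hI := fun I : ProperSubset ℓ => G.sum_productT_mul_prod_exp_le I (z I) (hz I)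
    (mul_nonneg hs hm0.le) (hb I) hP
  set Z : ProperSubset ℓ → (∀ i, Fin n → A i) → (∀ i, Fin n → X i) → ℝ := fun I a x =>
    ∑ k, z I (I.1.restrict fun i => a i k) (fun i => x i k) with hZ
  -- Centring by `L I` makes every moment at most 1 although the `p I` differ; after Jensen only the
  -- average of the `L I` remains, and it is controlled by `∑ I, p I ≤ ω`.
  set L : ProperSubset ℓ → ℝ := fun I => n * (e * p I) with hL
  have hIZ : ∀ I, ∑ x, G.productT n x * ∑ a, P a x * Real.exp (s * m * Z I a x - L I) ≤ 1 := by
    intro I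
    have h1 : ∑ x, G.productT n x * ∑ a, P a x * Real.exp (s * m * Z I a x - L I)
        = (∑ x, G.productT n x * ∑ a, P a x * ∏ k, Real.exp
          (s * m * z I (I.1.restrict fun i => a i k) (fun i => x i k))) / Real.exp (L I) := by
      simp only [hZ, Real.exp_sub, Finset.mul_sum, Real.exp_sum, Finset.sum_div, mul_div_assoc]
    rw [h1]
    exact div_le_one_of_le₀ (hI I) (Real.exp_pos _).le
  have hsumL : (1 / m) * ∑ I, L I ≤ n * (e * ω / m) := by
    have he0 : 0 ≤ e := sub_nonneg.2 (Real.one_le_exp (mul_nonneg hs hm0.le))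
    have h1 : (1 / m) * ∑ I, L I = n * (e * (∑ I, p I) / m) := by
      simp only [hL, ← Finset.mul_sum]
      ring
    rw [h1]
    gcongr
    exact hω b
  have hpt : ∀ a x, G.productT n x * Real.exp (s * ((Finset.univ.filter fun k : Fin n =>
      G.V (fun i => a i k) (fun i => x i k) = true).card : ℝ))
      ≤ G.productT n x * (Real.exp (n * (e * ω / m)) *
        ∑ I, (1 / m) * Real.exp (s * m * Z I a x - L I)) := by
    intro a x
    -- The certificate covers only queries of positive probability, so null queries are split off.
    rcases ((G.productT_mem n).1 x).eq_or_lt with h0 | h0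
    · simp [← h0]
    refine mul_le_mul_of_nonneg_left ?_ h0.le
    have hT : ∀ k, 0 < G.T (fun i => x i k) := fun k =>
      lt_of_le_of_ne (G.T_mem.1 _) fun h => h0.ne'
        (Finset.prod_eq_zero (Finset.mem_univ k) h.symm)
    have hcount : ((Finset.univ.filter fun k : Fin n =>
        G.V (fun i => a i k) (fun i => x i k) = true).card : ℝ) ≤ ∑ I, Z I a x := by
      rw [Finset.sum_comm, Finset.card_filter, Nat.cast_sum]
      refine Finset.sum_le_sum fun k _ => ?_
      split_ifs with h
      · simpa using hV _ _ h (hT k)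
      · simpa using Finset.sum_nonneg fun I _ => (hz I _ _).1
    have hjensen := convexOn_exp.map_sum_le (t := Finset.univ)
      (w := fun _ : ProperSubset ℓ => 1 / m) (p := fun I => s * m * Z I a x - L I)
      (fun _ _ => by positivity)
      (by rw [Finset.sum_const, Finset.card_univ, nsmul_eq_mul, hcard]; field_simp)
      (fun _ _ => Set.mem_univ _)
    simp only [smul_eq_mul] at hjensen
    refine le_trans ?_ (mul_le_mul_of_nonneg_left hjensen (Real.exp_pos _).le)
    rw [← Real.exp_add, Real.exp_le_exp]
    have h2 : ∑ I, 1 / m * (s * m * Z I a x - L I)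
        = s * ∑ I, Z I a x - (1 / m) * ∑ I, L I := by
      rw [Finset.mul_sum, Finset.mul_sum, ← Finset.sum_sub_distrib]
      refine Finset.sum_congr rfl fun I _ => ?_
      field_simp
    rw [h2]
    have h3 := mul_le_mul_of_nonneg_left hcount hs
    linarith
  calc ∑ x, G.productT n x * ∑ a, P a x * Real.exp (s * ((Finset.univ.filter fun k : Fin n =>
          G.V (fun i => a i k) (fun i => x i k) = true).card : ℝ))
      ≤ ∑ x, ∑ a, P a x * (G.productT n x * (Real.exp (n * (e * ω / m)) *
          ∑ I, (1 / m) * Real.exp (s * m * Z I a x - L I))) := by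
        refine Finset.sum_le_sum fun x _ => ?_
        rw [Finset.mul_sum]
        refine Finset.sum_le_sum fun a _ => ?_
        rw [mul_left_comm]
        exact mul_le_mul_of_nonneg_left (hpt a x) (hP.1 a x)
    _ = Real.exp (n * (e * ω / m)) * ∑ I, (1 / m) *
          ∑ x, G.productT n x * ∑ a, P a x * Real.exp (s * m * Z I a x - L I) := by
        simp only [Finset.mul_sum]
        symm
        rw [Finset.sum_comm]
        refine Finset.sum_congr rfl fun x _ => ?_
        rw [Finset.sum_comm]
        exact Finset.sum_congr rfl fun a _ => Finset.sum_congr rfl fun I _ => by ring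
    _ ≤ Real.exp (n * (e * ω / m)) * ∑ I : ProperSubset ℓ, (1 / m) * 1 := by
        gcongr with I
        exact hIZ I
    _ = Real.exp (n * (e * ω / m)) := by
        rw [Finset.sum_const, Finset.card_univ, nsmul_eq_mul, hcard]
        field_simp

/-! ### The Chernoff bound for threshold games. -/

theorem snosValue_thresholdRepetition_le [∀ i, Nonempty (A i)] (hℓ : 1 ≤ ℓ) (G : Game X A)
    {δ : ℝ} (hδ0 : 0 < δ) (hδ1 : δ < 1) (hG : G.snosValue ≤ 1 - δ) {n : ℕ} {α t : ℝ}
    (hα0 : 0 < α) (hα : α ≤ δ) (ht : (1 - δ + α) * n ≤ t) :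
    (G.thresholdRepetition n t).snosValue ≤ Real.exp (-(n * (α ^ 2 / (4 * (2 ^ ℓ - 1))))) := by
  refine Real.sSup_le ?_ (Real.exp_pos _).le
  rintro _ ⟨P, hP, rfl⟩
  have hm1 : (1 : ℝ) ≤ 2 ^ ℓ - 1 := by
    have : (2 : ℝ) ^ 1 ≤ 2 ^ ℓ := pow_le_pow_right₀ (by norm_num) hℓ
    linarith
  set m : ℝ := 2 ^ ℓ - 1 with hm
  have hm0 : 0 < m := by linarith
  -- This maximises the exponent `s * α - s ^ 2 * m`, and it keeps `s * m = α / 2` in the range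
  -- where `exp y - 1 ≤ y + y ^ 2`.
  set s : ℝ := α / (2 * m) with hs
  have hs0 : 0 < s := by positivity
  have hsm : s * m = α / 2 := by rw [hs]; field_simp
  have hmom := G.sum_productT_mul_exp_le hℓ
    (fun P hP => (G.winProb_le_snosValue hℓ hP).trans hG) hs0.le hP
  rw [← hm] at hmom
  have hmarkov : (G.thresholdRepetition n t).winProb P * Real.exp (s * t)
      ≤ Real.exp (n * ((Real.exp (s * m) - 1) * (1 - δ) / m)) := by
    refine le_trans ?_ hmom
    rw [winProb_eq, Finset.sum_mul]
    refine Finset.sum_le_sum fun x _ => ?_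
    rw [mul_assoc]
    refine mul_le_mul_of_nonneg_left ?_ ((G.productT_mem n).1 x)
    rw [Finset.sum_mul]
    refine Finset.sum_le_sum fun a _ => ?_
    rw [mul_comm _ (P a x), mul_assoc]
    refine mul_le_mul_of_nonneg_left ?_ (hP.1 a x)
    split_ifs with h
    · rw [one_mul, Real.exp_le_exp]
      exact mul_le_mul_of_nonneg_left (of_decide_eq_true h) hs0.le
    · rw [zero_mul]
      exact (Real.exp_pos _).le
  rw [← le_div_iff₀ (Real.exp_pos _), ← Real.exp_sub] at hmarkov
  refine hmarkov.trans (Real.exp_le_exp.2 ?_)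
  have hexp : Real.exp (s * m) - 1 ≤ s * m + (s * m) ^ 2 := by
    have := abs_le.1 (Real.abs_exp_sub_one_sub_id_le (x := s * m)
      (by rw [hsm, abs_of_pos (by linarith)]; linarith))
    linarith [this.2]
  have h1 : (Real.exp (s * m) - 1) * (1 - δ) / m ≤ s * (1 - δ) + s ^ 2 * m := by
    rw [div_le_iff₀ hm0]
    have h2 := mul_le_mul_of_nonneg_right hexp (by linarith : 0 ≤ 1 - δ)
    nlinarith [mul_nonneg (sq_nonneg (s * m)) hδ0.le]
  have h3 : (n : ℝ) * ((Real.exp (s * m) - 1) * (1 - δ) / m)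
      ≤ n * (s * (1 - δ) + s ^ 2 * m) := mul_le_mul_of_nonneg_left h1 n.cast_nonneg
  have h4 := mul_le_mul_of_nonneg_left ht hs0.le
  have h5 : s * α - s ^ 2 * m = α ^ 2 / (4 * m) := by
    rw [hs]
    field_simp
    ring
  have h6 : (n : ℝ) * (α ^ 2 / (4 * m)) = n * (s * α - s ^ 2 * m) := by rw [h5]
  linarith

end Game

/-! ### Perfect repetition and the final constants. -/

theorem Game.parallelRepetition_eq_thresholdRepetition {ℓ : ℕ} {X A : Fin ℓ → Type*}
    [∀ i, Fintype (X i)] (G : Game X A) (n : ℕ) :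
    G.parallelRepetition n = G.thresholdRepetition n n := by
  unfold Game.parallelRepetition Game.thresholdRepetition
  congr 1
  funext a x
  rw [decide_eq_decide, Nat.cast_le]
  constructor
  · intro h
    simp [h]
  · intro h k
    have h1 : (Finset.univ.filter fun k : Fin n =>
        G.V (fun i => a i k) (fun i => x i k) = true) = Finset.univ :=
      Finset.eq_univ_of_card _ (le_antisymm (Finset.card_le_univ _) (by simpa using h))
    simpa using h1.ge (Finset.mem_univ k)

/-- Weakening 4 to 5 pays for replacing the exponential by the form `1 - y / 5` of the bound on
`G^n`. -/
theorem exp_neg_le_one_sub {y : ℝ} (h0 : 0 ≤ y) (h1 : y ≤ 1) :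
    Real.exp (-(y / 4)) ≤ 1 - y / 5 := by
  rw [Real.exp_neg]
  refine inv_le_of_inv_le₀ (by linarith) (le_trans ?_ (Real.add_one_le_exp _))
  rw [inv_le_iff_one_le_mul₀ (by linarith)]
  nlinarith

theorem theorem1 {ℓ : ℕ} (hℓ : 1 ≤ ℓ) {X A : Fin ℓ → Type*}
    [∀ i, Fintype (X i)] [∀ i, Fintype (A i)] [∀ i, Nonempty (A i)]
    (G : Game X A) (δ : ℝ) (hδ0 : 0 < δ) (hδ1 : δ < 1) (hG : G.snosValue ≤ 1 - δ) :
    (∀ n : ℕ,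
      (G.parallelRepetition n).snosValue ≤ (1 - δ ^ 2 / (5 * playerConst ℓ ^ 2)) ^ n) ∧
    (∀ (n : ℕ) (α t : ℝ), 0 < α → α ≤ δ → (1 - δ + α) * n ≤ t →
      (G.thresholdRepetition n t).snosValue ≤
        Real.exp (-(n * (α ^ 2 / (5 * playerConst ℓ ^ 2))))) := by
  have hm1 : (1 : ℝ) ≤ 2 ^ ℓ - 1 := by
    have : (2 : ℝ) ^ 1 ≤ 2 ^ ℓ := pow_le_pow_right₀ (by norm_num) hℓ
    linarith
  have hmC : (2 : ℝ) ^ ℓ - 1 ≤ playerConst ℓ ^ 2 := by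
    have h1 : (2 : ℝ) ^ ℓ - 1 ≤ playerConst ℓ := by
      rw [playerConst, pow_succ]
      linarith
    nlinarith
  set m : ℝ := 2 ^ ℓ - 1 with hm
  refine ⟨fun n => ?_, fun n α t hα0 hα ht => ?_⟩
  · rw [G.parallelRepetition_eq_thresholdRepetition]
    -- With `α = δ` the threshold `(1 - δ + α) * n` is exactly `n`.
    refine (G.snosValue_thresholdRepetition_le hℓ hδ0 hδ1 hG hδ0 le_rfl (by simp)).trans ?_
    have hy1 : δ ^ 2 / m ≤ 1 := div_le_one_of_le₀ (by nlinarith) (by linarith)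
    have h1 := exp_neg_le_one_sub (y := δ ^ 2 / m) (by positivity) hy1
    have h2 : δ ^ 2 / (5 * playerConst ℓ ^ 2) ≤ δ ^ 2 / m / 5 := by
      rw [div_div, mul_comm m]
      gcongr
    have h3 : Real.exp (-(n * (δ ^ 2 / (4 * m)))) = Real.exp (-(δ ^ 2 / m / 4)) ^ n := by
      rw [← Real.exp_nat_mul, div_div, mul_comm m, mul_neg]
    rw [← hm, h3]
    exact pow_le_pow_left₀ (Real.exp_pos _).le (h1.trans (by linarith)) n
  · refine (G.snosValue_thresholdRepetition_le hℓ hδ0 hδ1 hG hα0 hα ht).trans ?_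
    rw [← hm, Real.exp_le_exp, neg_le_neg_iff]
    gcongr
    linarith
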